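/- Let $G$ be an additive (discrete) abelian group generated by one element $e$, let $N\in\mathbb N$, and let $e_i\in G^N$ be the element with $i$-th coordinate $e$ and all others $0$. For $f:G^N\to\mathbb R$ put $$\partial^i_+f(n)=f(n+e_i)-f(n),\qquad \partial^i_-f(n)=f(n)-f(n-e_i),\qquad \Delta=\sum_{i=1}^N\partial^i_+\partial^i_- ,$$ let $\tilde f(n,t)=(e^{t\Delta}f)(n)$ for $t\ge 0$ be the heat extension of $f$, and let $\|f\|_p=\big(\sum_{n\in G^N}|f(n)|^p\big)^{1/p}$. For $1<p<\infty$ let the Choi constant $\mathfrak C_p$ be the best (least) constant $C\in[0,\infty]$ such that, on every filtered probability space, $$\Big\|\sum_{k=0}^n\theta_kd_k\Big\|_{L^p}\le C\,\Big\|\sum_{k=0}^n d_k\Big\|_{L^p}\qquad\text{for all } n\ge 0,$$ for every difference sequence $(d_k)_{k\ge0}$ of a real-valued martingale $(X_k)_{k\ge 0}$ (that is, $d_0=X_0$ and $d_{k+1}=X_{k+1}-X_k$) and every predictable sequence $(\theta_k)_{k\ge0}$ with values in $\{0,1\}$. Let $1<p,q<\infty$ with $\frac1p+\frac1q=1$ and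 let $f,g:G^N\to\mathbb R$ be test functions, i.e. finitely supported. Then, for each of the two choices of the sign, $$2\sum_{i=1}^N\int_0^\infty\sum_{n\in G^N}\big[\partial^i_+\tilde f(n,t)\,\partial^i_+\tilde g(n,t)\big]_\pm\,dt\;\le\;\mathfrak C_p\,\|f\|_p\,\|g\|_q ,$$ where $[x]_+=\max\{x,0\}$ and $[x]_-=\max\{-x,0\}$. -/

import Mathlib

open MeasureTheory Set
open scoped ENNReal

namespace DiscreteRiesz

section Group

variable {G : Type*} [AddCommGroup G] {N : ℕ}

/-- The `i`-th unit element of `G ^ N`, for the generator `e` of `G`. -/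
def unitElt (e : G) (i : Fin N) : Fin N → G := Pi.single i e

/-- The right-hand partial derivative `f (n + e_i) - f n`. -/
def dPlus (e : G) (i : Fin N) (f : (Fin N → G) → ℝ) : (Fin N → G) → ℝ :=
  fun n => f (n + unitElt e i) - f n

/-- The left-hand partial derivative `f n - f (n - e_i)`. -/
def dMinus (e : G) (i : Fin N) (f : (Fin N → G) → ℝ) : (Fin N → G) → ℝ :=
  fun n => f n - f (n - unitElt e i)

/-- The discrete Laplacian `∑ i, ∂₊ⁱ ∂₋ⁱ`. -/
def laplacian (e : G) (f : (Fin N → G) → ℝ) : (Fin N → G) → ℝ :=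
  fun n => ∑ i : Fin N, dPlus e i (dMinus e i f) n

/-- The heat extension `exp (t Δ) f`, as the exponential series
`∑ k, t ^ k / k! * (Δ ^ k f) (n)` (absolutely convergent for bounded `f`,
see `summable_heatExt`). -/
noncomputable def heatExt (e : G) (f : (Fin N → G) → ℝ) (t : ℝ) (n : Fin N → G) : ℝ :=
  ∑' k : ℕ, t ^ k / (Nat.factorial k : ℝ) * ((laplacian e)^[k] f) n

theorem abs_laplacian_le (e : G) {f : (Fin N → G) → ℝ} {M : ℝ} (hf : ∀ n, |f n| ≤ M)
    (n : Fin N → G) : |laplacian e f n| ≤ 4 * N * M := by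
  have key : ∀ i ∈ (Finset.univ : Finset (Fin N)), |dPlus e i (dMinus e i f) n| ≤ 4 * M := by
    intro i _
    have h1 := abs_le.1 (hf (n + unitElt e i))
    have h2 := abs_le.1 (hf (n + unitElt e i - unitElt e i))
    have h3 := abs_le.1 (hf n)
    have h4 := abs_le.1 (hf (n - unitElt e i))
    unfold dPlus dMinus
    rw [abs_le]
    constructor <;> linarith [h1.1, h1.2, h2.1, h2.2, h3.1, h3.2, h4.1, h4.2]
  calc |laplacian e f n| ≤ ∑ i : Fin N, |dPlus e i (dMinus e i f) n| :=
        Finset.abs_sum_le_sum_abs _ _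
    _ ≤ ∑ _i : Fin N, 4 * M := Finset.sum_le_sum key
    _ = 4 * N * M := by simp; ring

/-- The exponential series defining `heatExt` converges for bounded functions. -/
theorem summable_heatExt (e : G) {f : (Fin N → G) → ℝ} {M : ℝ} (hf : ∀ n, |f n| ≤ M)
    (t : ℝ) (n : Fin N → G) :
    Summable fun k : ℕ => t ^ k / (Nat.factorial k : ℝ) * ((laplacian e)^[k] f) n := by
  have hb : ∀ (k : ℕ) (n : Fin N → G), |((laplacian e)^[k] f) n| ≤ (4 * N) ^ k * M := by
    intro k
    induction k with
    | zero => intro n; simpa using hf n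
    | succ k ih =>
      intro n
      rw [Function.iterate_succ_apply']
      refine (abs_laplacian_le e ih n).trans (le_of_eq ?_)
      ring
  refine Summable.of_norm_bounded
    (g := fun k : ℕ => (|t| * (4 * N)) ^ k / (Nat.factorial k : ℝ) * M)
    ((Real.summable_pow_div_factorial _).mul_right M) ?_
  intro k
  rw [Real.norm_eq_abs, abs_mul, abs_div, abs_pow, Nat.abs_cast]
  calc |t| ^ k / (Nat.factorial k : ℝ) * |((laplacian e)^[k] f) n|
      ≤ |t| ^ k / (Nat.factorial k : ℝ) * ((4 * N) ^ k * M) := by gcongr; exact hb k n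
    _ = _ := by rw [mul_pow]; ring

/-- The norm of `L ^ p (G ^ N)` with respect to the counting measure. -/
noncomputable def lpNorm (p : ℝ) (f : (Fin N → G) → ℝ) : ℝ≥0∞ :=
  (∑' n, ‖f n‖ₑ ^ p) ^ (1 / p)

/-- The quantity `2 ∑ i, ∫₀^∞ ∑ n, φ (∂₊ⁱ f̃ (n, t) * ∂₊ⁱ g̃ (n, t)) dt`, for a
function `φ` such as the positive or the negative part, with values in `[0, ∞]`. -/
noncomputable def bilinearForm (φ : ℝ → ℝ) (e : G) (f g : (Fin N → G) → ℝ) : ℝ≥0∞ :=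
  2 * ∑ i : Fin N, ∫⁻ t in Ioi (0 : ℝ), ∑' n : Fin N → G,
    ENNReal.ofReal (φ (dPlus e i (heatExt e f t) n * dPlus e i (heatExt e g t) n))

end Group

/-- The difference sequence of `X`: `d₀ = X₀` and `d_{k+1} = X_{k+1} - X_k`. -/
def diffSeq {Ω : Type*} (X : ℕ → Ω → ℝ) : ℕ → Ω → ℝ
  | 0 => X 0
  | k + 1 => X (k + 1) - X k

/-- `C` is admissible in Choi's inequality with exponent `p`: for every real martingale difference
sequence `d` and every predictable sequence `θ` with values in `{0, 1}`,
`‖∑ k ≤ n, θ k * d k‖_p ≤ C * ‖∑ k ≤ n, d k‖_p` for all `n`. -/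
def ChoiInequality (p : ℝ) (C : ℝ≥0∞) : Prop :=
  ∀ (Ω : Type) (m : MeasurableSpace Ω) (μ : Measure Ω) (_ : IsProbabilityMeasure μ)
    (ℱ : Filtration ℕ m) (X θ : ℕ → Ω → ℝ),
    Martingale X ℱ μ → IsStronglyPredictable ℱ θ → (∀ k ω, θ k ω = 0 ∨ θ k ω = 1) →
    ∀ n : ℕ,
      eLpNorm (fun ω => ∑ k ∈ Finset.range (n + 1), θ k ω * diffSeq X k ω) (ENNReal.ofReal p) μ
        ≤ C * eLpNorm (fun ω => ∑ k ∈ Finset.range (n + 1), diffSeq X k ω) (ENNReal.ofReal p) μ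

/-- The Choi constant: the best constant in Choi's inequality. -/
noncomputable def choiConst (p : ℝ) : ℝ≥0∞ := sInf {C | ChoiInequality p C}

end DiscreteRiesz

/-!
The inequality is proved directly in discrete time, by testing Choi's inequality against a walk on
`V = G ^ N` which is driven by independent biased coins.

A walk takes, one after another, the steps `e_0, …, e_{N-1}, -e_0, …, -e_{N-1}, e_0, …`, each of
them with probability `δ` only (`walk`). Let `w 0 = f` and let `w (r + 1)` be the average of `w r`
over one such step (`avgIter`). Then `w (n - k)`, evaluated at the position at time `k`, is a
martingale with terminal value `f`, and its increments are `(ξ - δ) * D w`, where `ξ` is the coin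
and `D w` is the difference of `w` in the direction of the step at hand (`walk_increment`). Run this
with `f` and with `g` along the same walk. Since a single direction is at stake at each time, the
sign of the product of the two differences is known before the coin is thrown. So "keep the
increment if the product is positive" is a predictable `{0, 1}`-valued sequence, and the
expectation of the transform of the `f`-martingale times the `g`-martingale is
`δ (1 - δ) ∑ E [D w_f * D w_g]_+` (`integral_selectedSum_mul`). Choi's inequality and Hölder's
inequality bound it (`sum_lintegral_walk_le`); summing over all starting points, under which the
counting measure is invariant, removes the walk from the estimate
(`sum_tsum_diffDir_avgIter_le`).

For `δ = 1 / K` the averages over `⌊K t⌋` rounds of `2 N` steps converge pointwise to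
`exp (t Δ) f` (`tendsto_avgIter`): in the Banach algebra of operators on bounded functions the
commuting contractions `1 + δ D` are `O(δ ^ 2)`-close to `exp (δ D)`, and the differences in the
directions `± e_i` add up to `Δ`. The sums over steps are Riemann sums of the integral over `t`, so
Fatou's lemma gives the bound for the heat extensions (`lintegral_sum_tsum_diffDir_exp_le`). The
directions `e_i` and `-e_i` contribute equally, hence the factor `2`, and the negative part is the
positive part for `-f` and `g`.
-/

namespace DiscreteRiesz

/-! ### A walk driven by biased coins -/

/-- The law of infinitely many independent coins, each showing `true` with probability `δ`. -/
noncomputable def coinMeasure (δ : unitInterval) : Measure (ℕ → Bool) :=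
  Measure.infinitePi fun _ => ProbabilityTheory.bernoulliMeasure true false δ

instance (δ : unitInterval) : IsProbabilityMeasure (coinMeasure δ) := by
  unfold coinMeasure; infer_instance

/-- The outcome of the `k`-th coin as a number in `{0, 1}`. -/
def coin (k : ℕ) (ω : ℕ → Bool) : ℝ := if ω k then 1 else 0

theorem measurable_coin (k : ℕ) : Measurable (coin k) :=
  (measurable_of_countable fun b : Bool => if b then (1 : ℝ) else 0).comp (measurable_pi_apply k)

/-- The `σ`-algebra at time `k` is generated by the coins with numbers `0, …, k`. -/
noncomputable def coinFiltration : Filtration ℕ (inferInstance : MeasurableSpace (ℕ → Bool)) :=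
  Filtration.natural coin fun k => (measurable_coin k).stronglyMeasurable

theorem coin_eq_zero_or_one (k : ℕ) (ω : ℕ → Bool) : coin k ω = 0 ∨ coin k ω = 1 := by
  unfold coin; split_ifs <;> simp

theorem abs_coin_sub_le (δ : unitInterval) (k : ℕ) (ω : ℕ → Bool) : |coin k ω - δ| ≤ 1 := by
  have h0 := δ.2.1
  have h1 := δ.2.2
  rcases coin_eq_zero_or_one k ω with h | h <;> rw [h, abs_le] <;> constructor <;> linarith

theorem measurableSet_coin (k : ℕ) : MeasurableSet[coinFiltration k] {ω | ω k = true} := by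
  have h : {ω : ℕ → Bool | ω k = true} = coin k ⁻¹' {1} := by
    ext ω; simp [coin]
  rw [h]
  exact (Filtration.stronglyAdapted_natural
    (fun k => (measurable_coin k).stronglyMeasurable) k).measurable (measurableSet_singleton 1)

theorem integral_coin (δ : unitInterval) (k : ℕ) : ∫ ω, coin k ω ∂coinMeasure δ = δ := by
  have h : ∫ ω, coin k ω ∂coinMeasure δ = ∫ b : Bool, (if b then (1 : ℝ) else 0)
      ∂((coinMeasure δ).map fun ω => ω k) := by
    rw [integral_map (measurable_pi_apply k).aemeasurable
      (measurable_of_countable _).aestronglyMeasurable]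
    rfl
  have h2 : (coinMeasure δ).map (fun ω => ω k) =
      ProbabilityTheory.bernoulliMeasure true false δ :=
    Measure.infinitePi_map_eval _ k
  rw [h, h2, ProbabilityTheory.integral_bernoulliMeasure]
  simp

theorem iIndepFun_coin (δ : unitInterval) : ProbabilityTheory.iIndepFun coin (coinMeasure δ) :=
  ProbabilityTheory.iIndepFun_infinitePi
    (X := fun _ (b : Bool) => if b then (1 : ℝ) else 0) fun _ => measurable_of_countable _

theorem integrable_of_bounded (δ : unitInterval) {A : (ℕ → Bool) → ℝ} {M : ℝ} (hA : Measurable A)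
    (hM : ∀ ω, |A ω| ≤ M) : Integrable A (coinMeasure δ) :=
  Integrable.of_bound hA.aestronglyMeasurable M (.of_forall hM)

/-- A centred coin is orthogonal to every bounded random variable known before it is thrown. -/
theorem integral_mul_coin_sub (δ : unitInterval) (k : ℕ) {A : (ℕ → Bool) → ℝ}
    (hA : Measurable[coinFiltration k] A) :
    ∫ ω, A ω * (coin (k + 1) ω - δ) ∂coinMeasure δ = 0 := by
  have hind : ProbabilityTheory.IndepFun (coin (k + 1)) A (coinMeasure δ) := by
    have h := (iIndepFun_coin δ).indep_comap_natural_of_lt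
      (fun k => (measurable_coin k).stronglyMeasurable) (Nat.lt_succ_self k)
    exact ProbabilityTheory.indep_of_indep_of_le_right h hA.comap_le
  have hind' : ProbabilityTheory.IndepFun A (fun ω => coin (k + 1) ω - δ) (coinMeasure δ) :=
    (hind.comp (φ := fun x : ℝ => x - δ) (ψ := id) (by fun_prop) measurable_id).symm
  have hm : Measurable A := hA.mono (coinFiltration.le k) le_rfl
  rw [hind'.integral_fun_mul_eq_mul_integral hm.aestronglyMeasurable
    ((measurable_coin _).sub_const _).aestronglyMeasurable, integral_sub, integral_coin]
  · simp
  · exact integrable_of_bounded δ (M := 1) (measurable_coin _) fun ω => by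
      rcases coin_eq_zero_or_one (k + 1) ω with h | h <;> simp [h]
  · exact integrable_const _

section Walk

variable {V : Type*} [AddCommGroup V]

/-- The walk from `x` which at time `k` takes the step `b k` if the coin `k + 1` shows `true`. -/
def walk (x : V) (b : ℕ → V) : ℕ → (ℕ → Bool) → V
  | 0, _ => x
  | k + 1, ω => walk x b k ω + if ω (k + 1) then b k else 0

/-- The position at time `k` is determined by the coins up to number `k`. It is stated for
functions of the position, so that `V` needs no `σ`-algebra. -/
theorem measurable_walk {β : Type*} [MeasurableSpace β] (x : V) (b : ℕ → V) (k : ℕ) :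
    ∀ h : V → β, Measurable[coinFiltration k] fun ω => h (walk x b k ω) := by
  induction k with
  | zero => intro h; simp only [walk]; exact measurable_const
  | succ k ih =>
    intro h
    have e : (fun ω => h (walk x b (k + 1) ω)) =
        fun ω => if ω (k + 1) = true then h (walk x b k ω + b k) else h (walk x b k ω) := by
      funext ω; simp only [walk]; split_ifs <;> simp
    rw [e]
    have hle := coinFiltration.mono (Nat.le_succ k)
    exact Measurable.ite (measurableSet_coin (k + 1))
      ((ih fun z => h (z + b k)).mono hle le_rfl) ((ih h).mono hle le_rfl)

theorem measurable_walk' {β : Type*} [MeasurableSpace β] (x : V) (b : ℕ → V) (k : ℕ)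
    (h : V → β) : Measurable fun ω => h (walk x b k ω) :=
  (measurable_walk x b k h).mono (coinFiltration.le k) le_rfl

theorem walk_eq_add (x : V) (b : ℕ → V) (k : ℕ) (ω : ℕ → Bool) :
    walk x b k ω = x + walk 0 b k ω := by
  induction k with
  | zero => simp [walk]
  | succ k ih => simp only [walk]; rw [ih, add_assoc]

/-! ### The martingales along the walk -/

/-- The difference of `w` in direction `v`. -/
def diffDir (v : V) (w : V → ℝ) (z : V) : ℝ := w (z + v) - w z

/-- The averaging operator of one throw: the walk steps by `v` with probability `δ`. -/
def avgStep (δ : ℝ) (v : V) (w : V → ℝ) (z : V) : ℝ := w z + δ * diffDir v w z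

/-- If `u k` is the average of `u (k + 1)` over the step at time `k`, the increments of `u`
along the walk are centred coins with a predictable factor. -/
theorem walk_increment {δ : unitInterval} {b : ℕ → V} {u : ℕ → V → ℝ}
    (hu : ∀ k, u k = avgStep δ (b k) (u (k + 1))) (x : V) (k : ℕ) (ω : ℕ → Bool) :
    u (k + 1) (walk x b (k + 1) ω) =
      u k (walk x b k ω) + diffDir (b k) (u (k + 1)) (walk x b k ω) * (coin (k + 1) ω - δ) := by
  rw [hu k]
  simp only [walk, avgStep, diffDir, coin]
  by_cases h : ω (k + 1) = true
  · simp only [h, if_true]; ring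
  · simp only [h]; simp; ring

theorem abs_diffDir_le {w : V → ℝ} {M : ℝ} (hM : ∀ z, |w z| ≤ M) (v z : V) :
    |diffDir v w z| ≤ 2 * M := by
  unfold diffDir
  have h1 := abs_le.1 (hM (z + v))
  have h2 := abs_le.1 (hM z)
  rw [abs_le]; constructor <;> linarith [h1.1, h1.2, h2.1, h2.2]

theorem martingale_walk {δ : unitInterval} {b : ℕ → V} {u : ℕ → V → ℝ}
    (hu : ∀ k, u k = avgStep δ (b k) (u (k + 1))) {M : ℝ} (hM : ∀ k z, |u k z| ≤ M) (x : V) :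
    Martingale (fun k ω => u k (walk x b k ω)) coinFiltration (coinMeasure δ) := by
  have hint : ∀ k, Integrable (fun ω => u k (walk x b k ω)) (coinMeasure δ) := fun k =>
    integrable_of_bounded δ (measurable_walk' x b k (u k)) fun ω => hM k _
  refine martingale_of_setIntegral_eq_succ
    (fun k => (measurable_walk x b k (u k)).stronglyMeasurable) hint fun k s hs => ?_
  have hs' := coinFiltration.le k s hs
  have h := integral_mul_coin_sub δ k
    (A := s.indicator fun ω => diffDir (b k) (u (k + 1)) (walk x b k ω))
    ((measurable_walk x b k _).indicator hs)
  rw [eq_comm, ← sub_eq_zero, ← integral_sub (hint _).integrableOn (hint _).integrableOn,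
    ← integral_indicator hs', ← h]
  congr 1
  funext ω
  by_cases hω : ω ∈ s
  · simp only [indicator_of_mem hω]
    rw [walk_increment hu]; ring
  · simp [indicator_of_notMem hω]

/-- The `{0, 1}`-valued sequence which selects the increment at time `k + 1` exactly if the two
differences met at time `k` have the same sign. -/
noncomputable def signSelect (b : ℕ → V) (u v : ℕ → V → ℝ) (x : V) : ℕ → (ℕ → Bool) → ℝ
  | 0, _ => 0
  | k + 1, ω =>
    if 0 < diffDir (b k) (u (k + 1)) (walk x b k ω) * diffDir (b k) (v (k + 1)) (walk x b k ω)
    then 1 else 0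

theorem signSelect_eq_zero_or_one (b : ℕ → V) (u v : ℕ → V → ℝ) (x : V) (k : ℕ) (ω : ℕ → Bool) :
    signSelect b u v x k ω = 0 ∨ signSelect b u v x k ω = 1 := by
  cases k with
  | zero => exact Or.inl rfl
  | succ k => simp only [signSelect]; split_ifs <;> simp

theorem measurable_signSelect (b : ℕ → V) (u v : ℕ → V → ℝ) (x : V) (k : ℕ) :
    Measurable[coinFiltration k] (signSelect b u v x (k + 1)) :=
  measurable_walk x b k fun z => if 0 < diffDir (b k) (u (k + 1)) z * diffDir (b k) (v (k + 1)) z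
    then (1 : ℝ) else 0

theorem isStronglyPredictable_signSelect (b : ℕ → V) (u v : ℕ → V → ℝ) (x : V) :
    IsStronglyPredictable coinFiltration (signSelect b u v x) :=
  IsStronglyPredictable.of_measurable_add_one (stronglyMeasurable_const (b := (0 : ℝ)))
    fun k => (measurable_signSelect b u v x k).stronglyMeasurable

/-- The martingale transform of `u` along the walk by `signSelect`. -/
noncomputable def selectedSum (b : ℕ → V) (u v : ℕ → V → ℝ) (x : V) (n : ℕ) (ω : ℕ → Bool) : ℝ :=
  ∑ k ∈ Finset.range (n + 1),
    signSelect b u v x k ω * diffSeq (fun k ω => u k (walk x b k ω)) k ω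

section

variable {δ : unitInterval} {b : ℕ → V} {u v : ℕ → V → ℝ}

theorem selectedSum_zero (x : V) (ω : ℕ → Bool) : selectedSum b u v x 0 ω = 0 := by
  simp [selectedSum, signSelect]

theorem selectedSum_succ (hu : ∀ k, u k = avgStep δ (b k) (u (k + 1))) (x : V) (n : ℕ)
    (ω : ℕ → Bool) :
    selectedSum b u v x (n + 1) ω = selectedSum b u v x n ω +
      signSelect b u v x (n + 1) ω * diffDir (b n) (u (n + 1)) (walk x b n ω) *
        (coin (n + 1) ω - δ) := by
  rw [selectedSum, Finset.sum_range_succ, ← selectedSum]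
  congr 1
  simp only [diffSeq, Pi.sub_apply]
  rw [walk_increment hu]; ring

theorem measurable_selectedSum (hu : ∀ k, u k = avgStep δ (b k) (u (k + 1))) (x : V) (n : ℕ) :
    Measurable[coinFiltration n] (selectedSum b u v x n) := by
  induction n with
  | zero =>
    rw [show selectedSum b u v x 0 = fun _ => 0 from funext fun ω => selectedSum_zero x ω]
    exact measurable_const
  | succ n ih =>
    have hle := coinFiltration.mono (Nat.le_succ n)
    rw [show selectedSum b u v x (n + 1) = _ from funext fun ω => selectedSum_succ hu x n ω]
    have hc : Measurable[coinFiltration (n + 1)] (coin (n + 1)) :=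
      (Filtration.stronglyAdapted_natural
        (fun k => (measurable_coin k).stronglyMeasurable) (n + 1)).measurable
    exact (ih.mono hle le_rfl).add ((((measurable_signSelect b u v x n).mono hle le_rfl).mul
      ((measurable_walk x b n (diffDir (b n) (u (n + 1)))).mono hle le_rfl)).mul
        (hc.sub_const _))

theorem exists_abs_selectedSum_le (hu : ∀ k, u k = avgStep δ (b k) (u (k + 1))) {M : ℝ}
    (hM : ∀ k z, |u k z| ≤ M) (x : V) (n : ℕ) : ∃ B, ∀ ω, |selectedSum b u v x n ω| ≤ B := by
  induction n with
  | zero => exact ⟨0, fun ω => by simp [selectedSum_zero]⟩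
  | succ n ih =>
    obtain ⟨B, hB⟩ := ih
    refine ⟨B + 1 * (2 * M) * 1, fun ω => ?_⟩
    rw [selectedSum_succ hu]
    refine (abs_add_le _ _).trans (add_le_add (hB ω) ?_)
    rw [abs_mul, abs_mul]
    have h1 : |signSelect b u v x (n + 1) ω| ≤ 1 := by
      rcases signSelect_eq_zero_or_one b u v x (n + 1) ω with h | h <;> simp [h]
    have h2 := abs_diffDir_le (hM (n + 1)) (b n) (walk x b n ω)
    have h3 := abs_coin_sub_le δ (n + 1) ω
    have h4 : 0 ≤ 2 * M := (abs_nonneg _).trans h2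
    gcongr

/-- The expectation of the selected transform of `u` against `v` only sees the selected products
of increments: all other terms carry an independent centred factor. -/
theorem integral_selectedSum_mul (hu : ∀ k, u k = avgStep δ (b k) (u (k + 1)))
    (hv : ∀ k, v k = avgStep δ (b k) (v (k + 1))) {M : ℝ} (hMu : ∀ k z, |u k z| ≤ M)
    (hMv : ∀ k z, |v k z| ≤ M) (x : V) (n : ℕ) :
    ∫ ω, selectedSum b u v x n ω * v n (walk x b n ω) ∂coinMeasure δ =
      ∑ k ∈ Finset.range n, δ * (1 - δ) * ∫ ω, max (diffDir (b k) (u (k + 1)) (walk x b k ω) *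
        diffDir (b k) (v (k + 1)) (walk x b k ω)) 0 ∂coinMeasure δ := by
  induction n with
  | zero => simp [selectedSum_zero]
  | succ n ih =>
    rw [Finset.sum_range_succ, ← ih]
    obtain ⟨B, hB⟩ := exists_abs_selectedSum_le (v := v) hu hMu x n
    set S := selectedSum b u v x n
    set Y := fun ω => v n (walk x b n ω)
    set H := fun ω => diffDir (b n) (u (n + 1)) (walk x b n ω)
    set K := fun ω => diffDir (b n) (v (n + 1)) (walk x b n ω)
    set T := signSelect b u v x (n + 1)
    set P := fun ω => max (H ω * K ω) 0
    have hTHK : ∀ ω, T ω * H ω * K ω = P ω := fun ω => by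
      simp only [T, signSelect, P, H, K]
      split_ifs with h
      · rw [one_mul, max_eq_left h.le]
      · rw [zero_mul, zero_mul, max_eq_right (not_lt.1 h)]
    have mS : Measurable[coinFiltration n] S := measurable_selectedSum hu x n
    have mY : Measurable[coinFiltration n] Y := measurable_walk x b n _
    have mH : Measurable[coinFiltration n] H := measurable_walk x b n _
    have mK : Measurable[coinFiltration n] K := measurable_walk x b n _
    have mT : Measurable[coinFiltration n] T := measurable_signSelect b u v x n
    have mP : Measurable[coinFiltration n] P := (mH.mul mK).max measurable_const
    -- on `{0, 1}` the square of a centred coin is affine in the coin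
    have key : ∀ ω, selectedSum b u v x (n + 1) ω * v (n + 1) (walk x b (n + 1) ω) =
        S ω * Y ω + (S ω * K ω + T ω * H ω * Y ω + (1 - 2 * δ) * P ω) * (coin (n + 1) ω - δ) +
          δ * (1 - δ) * P ω := fun ω => by
      rw [selectedSum_succ hu, walk_increment hv, ← hTHK]
      change (S ω + T ω * H ω * _) * (Y ω + K ω * _) = _
      rcases coin_eq_zero_or_one (n + 1) ω with h | h <;> rw [h] <;> ring
    have hM0 : 0 ≤ M := (abs_nonneg _).trans (hMu 0 x)
    have bY : ∀ ω, |Y ω| ≤ M := fun ω => hMv _ _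
    have bH : ∀ ω, |H ω| ≤ 2 * M := fun ω => abs_diffDir_le (hMu _) _ _
    have bK : ∀ ω, |K ω| ≤ 2 * M := fun ω => abs_diffDir_le (hMv _) _ _
    have bT : ∀ ω, |T ω| ≤ 1 := fun ω => by
      rcases signSelect_eq_zero_or_one b u v x (n + 1) ω with h | h <;> simp [T, h]
    have bP : ∀ ω, |P ω| ≤ 1 * (2 * M) * (2 * M) := fun ω => by
      rw [← hTHK, abs_mul, abs_mul]
      have := bT ω; have := bH ω; have := bK ω
      gcongr
    have hle := coinFiltration.le n
    have i1 : Integrable (fun ω => S ω * Y ω) (coinMeasure δ) :=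
      integrable_of_bounded δ ((mS.mul mY).mono hle le_rfl) (M := B * M) fun ω => by
        rw [abs_mul]
        exact mul_le_mul (hB ω) (bY ω) (abs_nonneg _) ((abs_nonneg _).trans (hB ω))
    have i3 : Integrable (fun ω => δ * (1 - δ) * P ω) (coinMeasure δ) :=
      (integrable_of_bounded δ (mP.mono hle le_rfl) bP).const_mul _
    have mA : Measurable[coinFiltration n]
        fun ω => S ω * K ω + T ω * H ω * Y ω + (1 - 2 * δ) * P ω :=
      ((mS.mul mK).add ((mT.mul mH).mul mY)).add (mP.const_mul _)
    have i2 : Integrable (fun ω => (S ω * K ω + T ω * H ω * Y ω + (1 - 2 * δ) * P ω) *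
        (coin (n + 1) ω - δ)) (coinMeasure δ) := by
      refine integrable_of_bounded δ
        ((mA.mono hle le_rfl).mul ((measurable_coin (n + 1)).sub_const _))
        (M := (B * (2 * M) + 1 * (2 * M) * M + |1 - 2 * (δ : ℝ)| * (1 * (2 * M) * (2 * M))) * 1)
        fun ω => ?_
      have hB0 : 0 ≤ B := (abs_nonneg _).trans (hB ω)
      have := hB ω; have := bT ω; have := bH ω; have := bK ω; have := bY ω; have := bP ω
      rw [abs_mul]
      refine mul_le_mul ?_ (abs_coin_sub_le δ _ ω) (abs_nonneg _) (by positivity)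
      refine (abs_add_le _ _).trans (add_le_add ((abs_add_le _ _).trans (add_le_add ?_ ?_)) ?_)
      · rw [abs_mul]; gcongr
      · rw [abs_mul, abs_mul]; gcongr
      · rw [abs_mul]; gcongr
    have e2 := integral_add (i1.add i2) i3
    simp only [Pi.add_apply] at e2
    rw [integral_congr_ae (.of_forall key), e2, integral_add i1 i2,
      integral_mul_coin_sub δ n mA, integral_const_mul, add_zero]

/-- Choi's inequality and Hölder's inequality along the walk from a fixed point. -/
theorem sum_lintegral_walk_le {p q : ℝ} (hpq : p.HolderConjugate q) {C : ℝ≥0∞}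
    (hC : ChoiInequality p C) (hu : ∀ k, u k = avgStep δ (b k) (u (k + 1)))
    (hv : ∀ k, v k = avgStep δ (b k) (v (k + 1))) {M : ℝ} (hMu : ∀ k z, |u k z| ≤ M)
    (hMv : ∀ k z, |v k z| ≤ M) (x : V) (n : ℕ) :
    ENNReal.ofReal (δ * (1 - δ)) * ∑ k ∈ Finset.range n,
        ∫⁻ ω, ENNReal.ofReal (max (diffDir (b k) (u (k + 1)) (walk x b k ω) *
          diffDir (b k) (v (k + 1)) (walk x b k ω)) 0) ∂coinMeasure δ ≤
      C * ((∫⁻ ω, ‖u n (walk x b n ω)‖ₑ ^ p ∂coinMeasure δ) ^ (1 / p) *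
        (∫⁻ ω, ‖v n (walk x b n ω)‖ₑ ^ q ∂coinMeasure δ) ^ (1 / q)) := by
  have h := hC (ℕ → Bool) inferInstance (coinMeasure δ) inferInstance coinFiltration
    (fun k ω => u k (walk x b k ω)) (signSelect b u v x) (martingale_walk hu hMu x)
    (isStronglyPredictable_signSelect b u v x) (signSelect_eq_zero_or_one b u v x) n
  have hsum : ∀ ω, ∑ k ∈ Finset.range (n + 1), diffSeq (fun k ω => u k (walk x b k ω)) k ω =
      u n (walk x b n ω) := fun ω => by
    rw [Finset.sum_range_succ']
    simp only [diffSeq, Pi.sub_apply]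
    rw [Finset.sum_range_sub fun k => u k (walk x b k ω)]
    ring
  simp only [hsum] at h
  have hp0 : ENNReal.ofReal p ≠ 0 := by simp [hpq.pos]
  rw [eLpNorm_eq_lintegral_rpow_enorm_toReal hp0 ENNReal.ofReal_ne_top,
    eLpNorm_eq_lintegral_rpow_enorm_toReal hp0 ENNReal.ofReal_ne_top,
    ENNReal.toReal_ofReal hpq.nonneg] at h
  have mS : Measurable (selectedSum b u v x n) :=
    (measurable_selectedSum hu x n).mono (coinFiltration.le n) le_rfl
  have hholder := ENNReal.lintegral_mul_le_Lp_mul_Lq (coinMeasure δ) hpq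
    (f := fun ω => ‖selectedSum b u v x n ω‖ₑ) (g := fun ω => ‖v n (walk x b n ω)‖ₑ)
    mS.enorm.aemeasurable (measurable_walk' x b n _).enorm.aemeasurable
  rw [← mul_assoc]
  refine le_trans ?_ (hholder.trans (mul_le_mul_left h _))
  have hδ : 0 ≤ (δ : ℝ) * (1 - δ) := mul_nonneg δ.2.1 (sub_nonneg.2 δ.2.2)
  have hterm : ∀ k, ∫⁻ ω, ENNReal.ofReal (max (diffDir (b k) (u (k + 1)) (walk x b k ω) *
      diffDir (b k) (v (k + 1)) (walk x b k ω)) 0) ∂coinMeasure δ =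
      ENNReal.ofReal (∫ ω, max (diffDir (b k) (u (k + 1)) (walk x b k ω) *
        diffDir (b k) (v (k + 1)) (walk x b k ω)) 0 ∂coinMeasure δ) := fun k => by
    refine (ofReal_integral_eq_lintegral_ofReal ?_ (.of_forall fun ω => le_max_right _ _)).symm
    refine integrable_of_bounded δ (measurable_walk' x b k fun z =>
      max (diffDir (b k) (u (k + 1)) z * diffDir (b k) (v (k + 1)) z) 0)
      (M := 2 * M * (2 * M)) fun ω => ?_
    have h1 := abs_diffDir_le (hMu (k + 1)) (b k) (walk x b k ω)
    have h2 := abs_diffDir_le (hMv (k + 1)) (b k) (walk x b k ω)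
    have h3 : 0 ≤ 2 * M := (abs_nonneg _).trans h1
    rw [abs_of_nonneg (le_max_right _ _)]
    refine max_le ((le_abs_self _).trans ?_) (mul_nonneg h3 h3)
    rw [abs_mul]; gcongr
  simp only [hterm]
  have hnonneg : ∀ k ∈ Finset.range n, 0 ≤ ∫ ω, max (diffDir (b k) (u (k + 1)) (walk x b k ω) *
      diffDir (b k) (v (k + 1)) (walk x b k ω)) 0 ∂coinMeasure δ := fun k _ =>
    integral_nonneg fun ω => le_max_right _ _
  rw [← ENNReal.ofReal_sum_of_nonneg hnonneg, ← ENNReal.ofReal_mul hδ, Finset.mul_sum,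
    ← integral_selectedSum_mul hu hv hMu hMv x n]
  refine (Real.ofReal_le_enorm _).trans ((enorm_integral_le_lintegral_enorm _).trans ?_)
  simp only [enorm_mul, Pi.mul_apply]
  exact le_rfl

end

/-! ### Summation over the starting points -/

/-- The function `f` averaged over the steps `c 0, …, c (r - 1)`. -/
def avgIter (δ : ℝ) (c : ℕ → V) (f : V → ℝ) : ℕ → V → ℝ
  | 0 => f
  | r + 1 => avgStep δ (c r) (avgIter δ c f r)

theorem abs_avgStep_le (δ : unitInterval) (v : V) {w : V → ℝ} {M : ℝ} (hM : ∀ z, |w z| ≤ M)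
    (z : V) : |avgStep δ v w z| ≤ M := by
  have e : avgStep δ v w z = (1 - δ) * w z + δ * w (z + v) := by
    simp only [avgStep, diffDir]; ring
  have h0 := δ.2.1
  have h1 : 0 ≤ 1 - (δ : ℝ) := sub_nonneg.2 δ.2.2
  rw [e]
  calc |(1 - (δ : ℝ)) * w z + δ * w (z + v)|
      ≤ |(1 - (δ : ℝ)) * w z| + |(δ : ℝ) * w (z + v)| := abs_add_le _ _
    _ = (1 - δ) * |w z| + δ * |w (z + v)| := by
        rw [abs_mul, abs_mul, abs_of_nonneg h0, abs_of_nonneg h1]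
    _ ≤ (1 - δ) * M + δ * M := by
        have := hM z; have := hM (z + v); gcongr
    _ = M := by ring

theorem abs_avgIter_le (δ : unitInterval) (c : ℕ → V) {f : V → ℝ} {M : ℝ}
    (hM : ∀ z, |f z| ≤ M) (r : ℕ) : ∀ z, |avgIter δ c f r z| ≤ M := by
  induction r with
  | zero => exact hM
  | succ r ih => exact abs_avgStep_le δ _ ih

/-- The counting measure is invariant under the walk. -/
theorem tsum_lintegral_walk [Countable V] (δ : unitInterval) (b : ℕ → V) (k : ℕ) (ψ : V → ℝ≥0∞) :
    ∑' x, ∫⁻ ω, ψ (walk x b k ω) ∂coinMeasure δ = ∑' z, ψ z := by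
  rw [← lintegral_tsum fun x => (measurable_walk' x b k ψ).aemeasurable]
  have h : ∀ ω, ∑' x, ψ (walk x b k ω) = ∑' z, ψ z := fun ω => by
    have e : (fun x => ψ (walk x b k ω)) = fun x => ψ (x + walk 0 b k ω) :=
      funext fun x => by rw [walk_eq_add]
    rw [e]
    exact (Equiv.addRight (walk 0 b k ω)).tsum_eq ψ
  simp [h]

/-- Hölder's inequality for sums of arbitrary families in `[0, ∞]`. -/
theorem tsum_rpow_mul_rpow_le {ι : Type*} {p q : ℝ} (hpq : p.HolderConjugate q)
    (A B : ι → ℝ≥0∞) :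
    ∑' x, A x ^ (1 / p) * B x ^ (1 / q) ≤ (∑' x, A x) ^ (1 / p) * (∑' x, B x) ^ (1 / q) := by
  let _ : MeasurableSpace ι := ⊤
  have h := ENNReal.lintegral_mul_le_Lp_mul_Lq Measure.count hpq
    (f := fun x => A x ^ (1 / p)) (g := fun x => B x ^ (1 / q))
    measurable_from_top.aemeasurable measurable_from_top.aemeasurable
  have hp : ∀ y : ℝ≥0∞, (y ^ (1 / p)) ^ p = y := fun y => by
    rw [← ENNReal.rpow_mul, one_div_mul_cancel hpq.ne_zero, ENNReal.rpow_one]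
  have hq : ∀ y : ℝ≥0∞, (y ^ (1 / q)) ^ q = y := fun y => by
    rw [← ENNReal.rpow_mul, one_div_mul_cancel hpq.symm.ne_zero, ENNReal.rpow_one]
  simpa only [lintegral_count, Pi.mul_apply, hp, hq] using h

/-- The discrete-time embedding inequality on `V`, obtained by summing over the starting points of
the walk. -/
theorem sum_tsum_diffDir_avgIter_le [Countable V] (δ : unitInterval) (c : ℕ → V) {p q : ℝ}
    (hpq : p.HolderConjugate q) {C : ℝ≥0∞} (hC : ChoiInequality p C) {f g : V → ℝ} {M : ℝ}
    (hf : ∀ z, |f z| ≤ M) (hg : ∀ z, |g z| ≤ M) (n : ℕ) :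
    ENNReal.ofReal (δ * (1 - δ)) * ∑ r ∈ Finset.range n, ∑' z, ENNReal.ofReal
        (max (diffDir (c r) (avgIter δ c f r) z * diffDir (c r) (avgIter δ c g r) z) 0) ≤
      C * ((∑' z, ‖f z‖ₑ ^ p) ^ (1 / p) * (∑' z, ‖g z‖ₑ ^ q) ^ (1 / q)) := by
  -- the walk takes the steps in reverse order and stays put after time `n`
  set b : ℕ → V := fun k => if k < n then c (n - 1 - k) else 0 with hb
  have hrec : ∀ (F : V → ℝ) (k : ℕ),
      avgIter δ c F (n - k) = avgStep δ (b k) (avgIter δ c F (n - (k + 1))) := fun F k => by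
    by_cases hk : k < n
    · have h1 : n - k = n - (k + 1) + 1 := by omega
      have h2 : n - 1 - k = n - (k + 1) := by omega
      rw [h1]
      simp only [hb, hk, if_true, h2, avgIter]
    · have h1 : n - k = 0 := by omega
      have h2 : n - (k + 1) = 0 := by omega
      funext z
      simp [hb, hk, h1, h2, avgStep, diffDir]
  have key : ∀ x, _ := fun x => sum_lintegral_walk_le (δ := δ) (b := b)
    (u := fun k => avgIter δ c f (n - k)) (v := fun k => avgIter δ c g (n - k)) hpq hC
    (hrec f) (hrec g) (fun k => abs_avgIter_le δ c hf _) (fun k => abs_avgIter_le δ c hg _) x n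
  have hsum := ENNReal.tsum_le_tsum key
  rw [ENNReal.tsum_mul_left, ENNReal.tsum_mul_left,
    Summable.tsum_finsetSum fun _ _ => ENNReal.summable] at hsum
  have hinv : ∀ k, ∑' x, ∫⁻ ω, ENNReal.ofReal
      (max (diffDir (b k) (avgIter δ c f (n - (k + 1))) (walk x b k ω) *
        diffDir (b k) (avgIter δ c g (n - (k + 1))) (walk x b k ω)) 0) ∂coinMeasure δ =
      ∑' z, ENNReal.ofReal (max (diffDir (b k) (avgIter δ c f (n - (k + 1))) z *
        diffDir (b k) (avgIter δ c g (n - (k + 1))) z) 0) := fun k =>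
    tsum_lintegral_walk δ b k fun z => ENNReal.ofReal
      (max (diffDir (b k) (avgIter δ c f (n - (k + 1))) z *
        diffDir (b k) (avgIter δ c g (n - (k + 1))) z) 0)
  simp only [hinv] at hsum
  have hrefl : ∑ k ∈ Finset.range n, ∑' z, ENNReal.ofReal
      (max (diffDir (b k) (avgIter δ c f (n - (k + 1))) z *
        diffDir (b k) (avgIter δ c g (n - (k + 1))) z) 0) =
      ∑ r ∈ Finset.range n, ∑' z, ENNReal.ofReal
        (max (diffDir (c r) (avgIter δ c f r) z * diffDir (c r) (avgIter δ c g r) z) 0) := by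
    rw [← Finset.sum_range_reflect]
    refine Finset.sum_congr rfl fun k hk => ?_
    have hk' := Finset.mem_range.1 hk
    have h1 : n - 1 - k < n := by omega
    have h2 : n - 1 - (n - 1 - k) = k := by omega
    have h3 : n - (n - 1 - k + 1) = k := by omega
    simp only [hb, h1, if_true, h2, h3]
  rw [hrefl] at hsum
  refine hsum.trans (mul_le_mul_right ((tsum_rpow_mul_rpow_le hpq _ _).trans ?_) C)
  rw [tsum_lintegral_walk δ b n fun z => ‖avgIter δ c f (n - n) z‖ₑ ^ p,
    tsum_lintegral_walk δ b n fun z => ‖avgIter δ c g (n - n) z‖ₑ ^ q, Nat.sub_self]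
  exact le_rfl

end Walk

/-! ### Products of near-identity elements in a Banach algebra -/

section BanachAlgebra

open Filter Topology

variable {𝔸 : Type*} [NormedRing 𝔸] [NormedAlgebra ℝ 𝔸] [CompleteSpace 𝔸]

/-- The exponential series beyond its linear part is dominated by the real one. -/
theorem norm_exp_sub_one_sub_le (x : 𝔸) :
    ‖NormedSpace.exp x - (1 + x)‖ ≤ Real.exp ‖x‖ - (1 + ‖x‖) := by
  have h1 := (hasSum_nat_add_iff' 2).2 (NormedSpace.exp_series_hasSum_exp' (𝕂 := ℝ) x)
  have h2 := (hasSum_nat_add_iff' 2).2 (NormedSpace.exp_series_hasSum_exp' (𝕂 := ℝ) ‖x‖)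
  rw [← Real.exp_eq_exp_ℝ] at h2
  simp only [Finset.sum_range_succ, Finset.sum_range_zero, Nat.factorial, pow_zero, pow_one,
    zero_add, Nat.cast_one, inv_one, one_smul, mul_one] at h1 h2
  rw [← h1.tsum_eq]
  refine tsum_of_norm_bounded h2 fun n => ?_
  rw [norm_smul, norm_inv, Real.norm_natCast, smul_eq_mul]
  gcongr
  exact norm_pow_le' x (Nat.succ_pos _)

theorem norm_exp_le_exp_norm (h1 : ‖(1 : 𝔸)‖ ≤ 1) (x : 𝔸) :
    ‖NormedSpace.exp x‖ ≤ Real.exp ‖x‖ := by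
  calc ‖NormedSpace.exp x‖ = ‖(NormedSpace.exp x - (1 + x)) + (1 + x)‖ := by rw [sub_add_cancel]
    _ ≤ ‖NormedSpace.exp x - (1 + x)‖ + (‖(1 : 𝔸)‖ + ‖x‖) :=
        (norm_add_le _ _).trans (by gcongr; exact norm_add_le _ _)
    _ ≤ (Real.exp ‖x‖ - (1 + ‖x‖)) + (1 + ‖x‖) := by
        gcongr; exact norm_exp_sub_one_sub_le x
    _ = Real.exp ‖x‖ := by ring

/-- The product `(1 + δ a_{s-1}) ⋯ (1 + δ a_0)`. -/
def nearOneProd (a : ℕ → 𝔸) (δ : ℝ) : ℕ → 𝔸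
  | 0 => 1
  | s + 1 => (1 + δ • a s) * nearOneProd a δ s

/-- For commuting `a i` the product of the factors `1 + δ a i` is close to the product of the
factors `exp (δ a i)`, by telescoping. -/
theorem norm_nearOneProd_sub_exp_le (h1 : ‖(1 : 𝔸)‖ ≤ 1) {a : ℕ → 𝔸}
    (hcomm : ∀ i j, Commute (a i) (a j)) {A δ : ℝ} (hA : ∀ i, ‖a i‖ ≤ A) (hδ : 0 ≤ δ)
    (hδA : δ * A ≤ 1) (hcontr : ∀ i, ‖1 + δ • a i‖ ≤ 1) (s : ℕ) :
    ‖nearOneProd a δ s - NormedSpace.exp (δ • ∑ i ∈ Finset.range s, a i)‖ ≤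
      s * (δ * A) ^ 2 * Real.exp (s * (δ * A)) := by
  have hA0 : 0 ≤ A := (norm_nonneg _).trans (hA 0)
  have hx : ∀ i, ‖δ • a i‖ ≤ δ * A := fun i => by
    rw [norm_smul, Real.norm_of_nonneg hδ]; gcongr; exact hA i
  induction s with
  | zero => simp [nearOneProd]
  | succ s ih =>
    set E := NormedSpace.exp (δ • ∑ i ∈ Finset.range s, a i)
    have hexp : NormedSpace.exp (δ • ∑ i ∈ Finset.range (s + 1), a i) =
        NormedSpace.exp (δ • a s) * E := by
      let _ : NormedAlgebra ℚ 𝔸 := NormedAlgebra.restrictScalars ℚ ℝ 𝔸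
      rw [Finset.sum_range_succ, add_comm, smul_add, NormedSpace.exp_add_of_commute]
      exact ((Commute.sum_right _ _ _ fun i _ => hcomm s i).smul_left δ).smul_right δ
    have hE : ‖E‖ ≤ Real.exp (s * (δ * A)) := by
      refine (norm_exp_le_exp_norm h1 _).trans (Real.exp_le_exp.2 ?_)
      rw [norm_smul, Real.norm_of_nonneg hδ]
      calc δ * ‖∑ i ∈ Finset.range s, a i‖ ≤ δ * ∑ i ∈ Finset.range s, ‖a i‖ := by
            gcongr; exact norm_sum_le _ _
        _ ≤ δ * ∑ _i ∈ Finset.range s, A := by gcongr with i; exact hA i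
        _ = s * (δ * A) := by simp; ring
    have hone : ‖NormedSpace.exp (δ • a s) - (1 + δ • a s)‖ ≤ (δ * A) ^ 2 := by
      have hx1 : ‖δ • a s‖ ≤ 1 := (hx s).trans hδA
      have h2 := Real.abs_exp_sub_one_sub_id_le (x := ‖δ • a s‖) (by rwa [abs_norm])
      have h3 := (norm_exp_sub_one_sub_le (δ • a s)).trans
        ((le_of_eq (by ring)).trans ((le_abs_self _).trans h2))
      exact h3.trans (by gcongr; exact hx s)
    have hsplit : nearOneProd a δ (s + 1) - NormedSpace.exp (δ • a s) * E =
        (1 + δ • a s) * (nearOneProd a δ s - E) -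
          (NormedSpace.exp (δ • a s) - (1 + δ • a s)) * E := by
      simp only [nearOneProd]; noncomm_ring
    rw [hexp, hsplit]
    have hδA0 : 0 ≤ δ * A := mul_nonneg hδ hA0
    have hmono : Real.exp (s * (δ * A)) ≤ Real.exp ((s + 1 : ℕ) * (δ * A)) := by
      apply Real.exp_le_exp.2; gcongr; simp
    calc _ ≤ ‖1 + δ • a s‖ * ‖nearOneProd a δ s - E‖ +
          ‖NormedSpace.exp (δ • a s) - (1 + δ • a s)‖ * ‖E‖ :=
          (norm_sub_le _ _).trans (add_le_add (norm_mul_le _ _) (norm_mul_le _ _))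
      _ ≤ 1 * (s * (δ * A) ^ 2 * Real.exp (s * (δ * A))) +
          (δ * A) ^ 2 * Real.exp (s * (δ * A)) := by
          gcongr; exact hcontr s
      _ = (s + 1 : ℕ) * (δ * A) ^ 2 * Real.exp (s * (δ * A)) := by push_cast; ring
      _ ≤ _ := by gcongr

/-- Products of the factors `1 + a i / K` over `⌊K t⌋` periods of a commuting periodic sequence
converge to the exponential of `t` times the sum over one period. -/
theorem tendsto_nearOneProd (h1 : ‖(1 : 𝔸)‖ ≤ 1) {a : ℕ → 𝔸}
    (hcomm : ∀ i j, Commute (a i) (a j)) {A : ℝ} (hA : ∀ i, ‖a i‖ ≤ A)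
    (hcontr : ∀ δ ∈ Icc (0 : ℝ) 1, ∀ i, ‖1 + δ • a i‖ ≤ 1) {M : ℕ}
    (hper : Function.Periodic a M) {t : ℝ} (ht : 0 ≤ t) (j : ℕ) :
    Tendsto (fun K : ℕ => nearOneProd a (1 / (K : ℝ)) (⌊t * K⌋₊ * M + j)) atTop
      (𝓝 (NormedSpace.exp (t • ∑ i ∈ Finset.range M, a i))) := by
  have hA0 : 0 ≤ A := (norm_nonneg _).trans (hA 0)
  have hfloor : Tendsto (fun K : ℕ => (⌊t * K⌋₊ : ℝ) / K) atTop (𝓝 t) :=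
    (tendsto_nat_floor_mul_div_atTop ht).comp tendsto_natCast_atTop_atTop
  have hinv : Tendsto (fun K : ℕ => 1 / (K : ℝ)) atTop (𝓝 0) := tendsto_one_div_atTop_nhds_zero_nat
  have hsum : ∀ r, ∑ i ∈ Finset.range (r * M + j), a i =
      (r : ℝ) • ∑ i ∈ Finset.range M, a i + ∑ i ∈ Finset.range j, a i := fun r => by
    induction r with
    | zero => simp
    | succ r ih =>
      have e : (r + 1) * M + j = M + (r * M + j) := by ring
      rw [e, Finset.sum_range_add]
      have e2 : ∀ x, a (M + x) = a x := fun x => by rw [add_comm]; exact hper x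
      simp only [e2, ih]
      push_cast
      rw [add_smul, one_smul]
      abel
  have hexp : Tendsto (fun K : ℕ => NormedSpace.exp ((1 / (K : ℝ)) •
      ∑ i ∈ Finset.range (⌊t * K⌋₊ * M + j), a i)) atTop
      (𝓝 (NormedSpace.exp (t • ∑ i ∈ Finset.range M, a i))) := by
    let _ : NormedAlgebra ℚ 𝔸 := NormedAlgebra.restrictScalars ℚ ℝ 𝔸
    refine (NormedSpace.exp_continuous.tendsto _).comp ?_
    have h := (hfloor.smul_const (∑ i ∈ Finset.range M, a i)).add
      (hinv.smul_const (∑ i ∈ Finset.range j, a i))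
    rw [zero_smul, add_zero] at h
    refine h.congr fun K => ?_
    rw [hsum, smul_add, smul_smul, one_div, div_eq_inv_mul]
  have hdiff : Tendsto (fun K : ℕ => nearOneProd a (1 / (K : ℝ)) (⌊t * K⌋₊ * M + j) -
      NormedSpace.exp ((1 / (K : ℝ)) • ∑ i ∈ Finset.range (⌊t * K⌋₊ * M + j), a i)) atTop
      (𝓝 0) := by
    have hs : Tendsto (fun K : ℕ => ((⌊t * K⌋₊ * M + j : ℕ) : ℝ) * (1 / (K : ℝ) * A)) atTop
        (𝓝 ((t * M + j * 0) * A)) := by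
      refine (((hfloor.mul_const (M : ℝ)).add (hinv.const_mul (j : ℝ))).mul_const A).congr
        fun K => ?_
      push_cast; ring
    have hb : Tendsto (fun K : ℕ => ((⌊t * K⌋₊ * M + j : ℕ) : ℝ) * (1 / (K : ℝ) * A) *
        (1 / (K : ℝ) * A) * Real.exp (((⌊t * K⌋₊ * M + j : ℕ) : ℝ) * (1 / (K : ℝ) * A))) atTop
        (𝓝 0) := by
      have h := (hs.mul (hinv.mul_const A)).mul ((Real.continuous_exp.tendsto _).comp hs)
      simpa using h
    refine squeeze_zero_norm' ?_ hb
    have hsmall : ∀ᶠ K : ℕ in atTop, 1 / (K : ℝ) * A < 1 := by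
      have h := hinv.mul_const A
      rw [zero_mul] at h
      exact h.eventually (gt_mem_nhds one_pos)
    filter_upwards [hsmall, eventually_ge_atTop 1] with K hK hK1
    have hK1' : (1 : ℝ) ≤ K := by exact_mod_cast hK1
    refine (norm_nearOneProd_sub_exp_le h1 hcomm hA (by positivity) hK.le
      (hcontr _ ⟨by positivity, (div_le_one (by positivity)).2 hK1'⟩) _).trans (le_of_eq ?_)
    ring
  simpa using hdiff.add hexp

theorem hasSum_map_exp_smul (φ : 𝔸 →L[ℝ] ℝ) (t : ℝ) (x : 𝔸) :
    HasSum (fun k : ℕ => t ^ k / (k.factorial : ℝ) * φ (x ^ k))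
      (φ (NormedSpace.exp (t • x))) := by
  convert φ.hasSum (NormedSpace.exp_series_hasSum_exp' (𝕂 := ℝ) (t • x)) using 2 with k
  rw [map_smul, smul_pow, map_smul, smul_eq_mul, smul_eq_mul]
  ring

end BanachAlgebra

/-! ### Difference operators on bounded functions -/

section Operators

open Filter Topology

/-- The Banach space of bounded functions on `V`. -/
abbrev BddFun (V : Type*) := lp (fun _ : V => ℝ) ∞

/-- A bounded function as an element of `BddFun V`. -/
def toBddFun {V : Type*} {f : V → ℝ} {M : ℝ} (hf : ∀ z, |f z| ≤ M) : BddFun V :=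
  ⟨f, memℓp_infty ⟨M, by rintro _ ⟨z, rfl⟩; exact hf z⟩⟩

/-- The bounded functional `T ↦ (T F) z` on operators. -/
noncomputable def evalOp {V : Type*} (F : BddFun V) (z : V) : (BddFun V →L[ℝ] BddFun V) →L[ℝ] ℝ :=
  (lp.evalCLM ℝ (fun _ : V => ℝ) ∞ z).comp (ContinuousLinearMap.apply ℝ (BddFun V) F)

theorem evalOp_apply {V : Type*} (F : BddFun V) (z : V) (T : BddFun V →L[ℝ] BddFun V) :
    evalOp F z T = T F z := rfl

variable {V : Type*} [AddCommGroup V]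

/-- The translation `F ↦ F (· + v)`. -/
noncomputable def shiftOp (v : V) : BddFun V →L[ℝ] BddFun V :=
  LinearMap.mkContinuous
    { toFun := fun F => toBddFun (f := fun z => F (z + v))
        fun z => lp.norm_apply_le_norm ENNReal.top_ne_zero F (z + v)
      map_add' := fun _ _ => rfl
      map_smul' := fun _ _ => rfl } 1 fun F => by
    rw [one_mul]
    exact lp.norm_le_of_forall_le (norm_nonneg F)
      fun z => lp.norm_apply_le_norm ENNReal.top_ne_zero F (z + v)

theorem norm_shiftOp_le (v : V) : ‖shiftOp v‖ ≤ 1 :=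
  LinearMap.mkContinuous_norm_le _ zero_le_one _

/-- The difference operator `F ↦ F (· + v) - F`. -/
noncomputable def diffOp (v : V) : BddFun V →L[ℝ] BddFun V := shiftOp v - 1

theorem norm_diffOp_le (v : V) : ‖diffOp v‖ ≤ 2 := by
  have h1 : ‖(1 : BddFun V →L[ℝ] BddFun V)‖ ≤ 1 := ContinuousLinearMap.norm_id_le
  refine (norm_sub_le _ _).trans ?_
  linarith [norm_shiftOp_le v]

theorem commute_diffOp (v w : V) : Commute (diffOp v) (diffOp w) := by
  have h : Commute (shiftOp v) (shiftOp w) := by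
    ext F z
    change F (z + v + w) = F (z + w + v)
    rw [add_right_comm]
  exact (h.sub_left (Commute.one_left _)).sub_right (Commute.one_right _)

theorem norm_one_add_smul_diffOp_le {δ : ℝ} (hδ : δ ∈ Icc (0 : ℝ) 1) (v : V) :
    ‖1 + δ • diffOp v‖ ≤ 1 := by
  have e : 1 + δ • diffOp v = (1 - δ) • (1 : BddFun V →L[ℝ] BddFun V) + δ • shiftOp v := by
    unfold diffOp; module
  have h1 : ‖(1 : BddFun V →L[ℝ] BddFun V)‖ ≤ 1 := ContinuousLinearMap.norm_id_le
  have h0 : 0 ≤ 1 - δ := sub_nonneg.2 hδ.2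
  rw [e]
  refine (norm_add_le _ _).trans ?_
  rw [norm_smul, norm_smul, Real.norm_of_nonneg hδ.1, Real.norm_of_nonneg h0]
  nlinarith [norm_shiftOp_le v, hδ.1]

/-- The heat semigroup `exp (t ∑ i < M, diffOp (c i))` applied to the bounded function `f`. -/
noncomputable def heatSemigroup (c : ℕ → V) (M : ℕ) {f : V → ℝ} {m : ℝ} (hf : ∀ z, |f z| ≤ m)
    (t : ℝ) (z : V) : ℝ :=
  NormedSpace.exp (t • ∑ i ∈ Finset.range M, diffOp (c i)) (toBddFun hf) z

theorem avgIter_eq_nearOneProd (c : ℕ → V) (δ : ℝ) {f : V → ℝ} {m : ℝ} (hf : ∀ z, |f z| ≤ m)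
    (s : ℕ) : ∀ z, avgIter δ c f s z =
      nearOneProd (fun i => diffOp (c i)) δ s (toBddFun hf) z := by
  induction s with
  | zero => intro z; rfl
  | succ s ih =>
    intro z
    simp only [avgIter, avgStep, diffDir, ih]
    rfl

theorem continuous_heatSemigroup (c : ℕ → V) (M : ℕ) {f : V → ℝ} {m : ℝ} (hf : ∀ z, |f z| ≤ m)
    (z : V) : Continuous fun t => heatSemigroup c M hf t z := by
  let _ : NormedAlgebra ℚ (BddFun V →L[ℝ] BddFun V) := NormedAlgebra.restrictScalars ℚ ℝ _
  exact (evalOp (toBddFun hf) z).continuous.comp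
    (NormedSpace.exp_continuous.comp (continuous_id.smul continuous_const))

/-- The random walk averages converge pointwise to the heat semigroup generated by the sum of the
differences over one period of the directions. -/
theorem tendsto_avgIter {c : ℕ → V} {M : ℕ} (hper : Function.Periodic c M) {f : V → ℝ} {m : ℝ}
    (hf : ∀ z, |f z| ≤ m) {t : ℝ} (ht : 0 ≤ t) (j : ℕ) (z : V) :
    Tendsto (fun K : ℕ => avgIter (1 / (K : ℝ)) c f (⌊t * K⌋₊ * M + j) z) atTop
      (𝓝 (heatSemigroup c M hf t z)) := by
  have h := tendsto_nearOneProd (𝔸 := BddFun V →L[ℝ] BddFun V) ContinuousLinearMap.norm_id_le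
    (a := fun i => diffOp (c i)) (fun i j => commute_diffOp _ _) (fun i => norm_diffOp_le _)
    (fun δ hδ i => norm_one_add_smul_diffOp_le hδ _) (M := M)
    (fun i => by simp only [hper i]) ht j
  simp only [avgIter_eq_nearOneProd _ _ hf]
  exact ((evalOp (toBddFun hf) z).continuous.tendsto _).comp h

end Operators

/-! ### Passage to continuous time -/

section Limit

open Filter Topology

/-- Fatou's lemma for sums. -/
theorem tsum_le_liminf_of_tendsto {ι : Type*} {a : ℕ → ι → ℝ≥0∞} {l : ι → ℝ≥0∞}
    (h : ∀ i, Tendsto (fun K => a K i) atTop (𝓝 (l i))) :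
    ∑' i, l i ≤ liminf (fun K => ∑' i, a K i) atTop := by
  let _ : MeasurableSpace ι := ⊤
  have hF := lintegral_liminf_le (μ := Measure.count) (u := atTop) (f := a)
    fun _ => measurable_from_top
  simp only [lintegral_count, fun i => (h i).liminf_eq] at hF
  exact hF

/-- A step function of mesh `1 / K` integrates to at most its Riemann sum. -/
theorem lintegral_floor_le {K : ℕ} (hK : 1 ≤ K) (Φ : ℕ → ℝ≥0∞) :
    ∫⁻ t in Ioi (0 : ℝ), Φ ⌊t * K⌋₊ ≤ ∑' r, ENNReal.ofReal (1 / K) * Φ r := by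
  have hK0 : (0 : ℝ) < K := by exact_mod_cast hK
  have hsub : Ioi (0 : ℝ) ⊆ ⋃ r : ℕ, Ico ((r : ℝ) / K) ((r + 1) / K) := fun t ht => by
    refine mem_iUnion.2 ⟨⌊t * K⌋₊, ?_, ?_⟩
    · rw [div_le_iff₀ hK0]
      exact Nat.floor_le (mul_nonneg (le_of_lt ht) hK0.le)
    · rw [lt_div_iff₀ hK0]
      exact Nat.lt_floor_add_one _
  refine (lintegral_mono_set hsub).trans ((lintegral_iUnion_le _ _).trans ?_)
  refine ENNReal.tsum_le_tsum fun r => ?_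
  rw [setLIntegral_congr_fun (g := fun _ => Φ r) measurableSet_Ico fun t ht => ?_]
  · rw [setLIntegral_const, Real.volume_Ico, mul_comm]
    gcongr
    rw [← sub_div]; simp
  · have h0 : (r : ℝ) ≤ t * K := (div_le_iff₀ hK0).1 ht.1
    have h1 : ⌊t * K⌋₊ = r := (Nat.floor_eq_iff ((Nat.cast_nonneg r).trans h0)).2
      ⟨h0, (lt_div_iff₀ hK0).1 ht.2⟩
    simp only [h1]

theorem sum_range_mul_eq_sum_sum {β : Type*} [AddCommMonoid β] (a : ℕ → β) (R M : ℕ) :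
    ∑ s ∈ Finset.range (R * M), a s =
      ∑ r ∈ Finset.range R, ∑ j ∈ Finset.range M, a (r * M + j) := by
  induction R with
  | zero => simp
  | succ R ih => rw [Finset.sum_range_succ, ← ih, add_mul, one_mul, Finset.sum_range_add]

variable {V : Type*} [AddCommGroup V]

/-- The embedding inequality for the heat semigroup generated by the differences in finitely many
directions, as the limit of the inequality for random walks with vanishing step probability. -/
theorem lintegral_sum_tsum_diffDir_exp_le [Countable V] {c : ℕ → V} {M : ℕ}
    (hper : Function.Periodic c M) {p q : ℝ} (hpq : p.HolderConjugate q) {C : ℝ≥0∞}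
    (hC : ChoiInequality p C) {f g : V → ℝ} {m : ℝ}
    (hf : ∀ z, |f z| ≤ m) (hg : ∀ z, |g z| ≤ m) :
    ∫⁻ t in Ioi (0 : ℝ), ∑ j : Fin M, ∑' z, ENNReal.ofReal (max
        (diffDir (c j) (heatSemigroup c M hf t) z *
          diffDir (c j) (heatSemigroup c M hg t) z) 0) ≤
      C * ((∑' z, ‖f z‖ₑ ^ p) ^ (1 / p) * (∑' z, ‖g z‖ₑ ^ q) ^ (1 / q)) := by
  set B := C * ((∑' z, ‖f z‖ₑ ^ p) ^ (1 / p) * (∑' z, ‖g z‖ₑ ^ q) ^ (1 / q))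
  have hcper : ∀ r j, c (r * M + j) = c j := fun r j => by
    rw [add_comm]; exact (hper.nat_mul r) j
  set P : ℕ → ℕ → V → ℝ := fun K s z => max
    (diffDir (c s) (avgIter (1 / (K : ℝ)) c f s) z *
      diffDir (c s) (avgIter (1 / (K : ℝ)) c g s) z) 0 with hP
  -- the factor `1 - 1 / K` is the variance of a coin divided by its mean
  set Φ : ℕ → ℕ → ℝ≥0∞ := fun K r => ∑' x : Fin M × V,
    ENNReal.ofReal ((1 - 1 / (K : ℝ)) * P K (r * M + x.1) x.2) with hΦ
  have hdisc : ∀ K : ℕ, 1 ≤ K → ∫⁻ t in Ioi (0 : ℝ), Φ K ⌊t * K⌋₊ ≤ B := fun K hK => by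
    have hK1 : (1 : ℝ) ≤ K := by exact_mod_cast hK
    have hδ : 1 / (K : ℝ) ∈ Icc (0 : ℝ) 1 :=
      ⟨by positivity, (div_le_one (by positivity)).2 hK1⟩
    have hδ1 : 0 ≤ 1 - 1 / (K : ℝ) := sub_nonneg.2 hδ.2
    refine (lintegral_floor_le hK _).trans (ENNReal.tsum_le_of_sum_range_le fun R => ?_)
    have h := sum_tsum_diffDir_avgIter_le ⟨1 / (K : ℝ), hδ⟩ c hpq hC hf hg (R * M)
    refine le_trans (le_of_eq ?_) h
    rw [sum_range_mul_eq_sum_sum, Finset.mul_sum]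
    refine Finset.sum_congr rfl fun r _ => ?_
    rw [ENNReal.ofReal_mul hδ.1, mul_assoc]
    congr 1
    simp only [hΦ]
    rw [ENNReal.tsum_prod (f := fun (j : Fin M) z =>
      ENNReal.ofReal ((1 - 1 / (K : ℝ)) * P K (r * M + j) z)),
      tsum_fintype, Finset.mul_sum, Finset.sum_range]
    refine Finset.sum_congr rfl fun j _ => ?_
    rw [← ENNReal.tsum_mul_left]
    exact tsum_congr fun z => ENNReal.ofReal_mul hδ1
  have hlim : ∀ t ∈ Ioi (0 : ℝ), ∑ j : Fin M, ∑' z, ENNReal.ofReal (max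
      (diffDir (c j) (heatSemigroup c M hf t) z *
        diffDir (c j) (heatSemigroup c M hg t) z) 0) ≤
      liminf (fun K : ℕ => Φ K ⌊t * K⌋₊) atTop := fun t ht => by
    rw [← tsum_fintype (L := .unconditional _), ← ENNReal.tsum_prod (f := fun (j : Fin M) z =>
      ENNReal.ofReal (max
        (diffDir (c j) (heatSemigroup c M hf t) z *
          diffDir (c j) (heatSemigroup c M hg t) z) 0))]
    refine tsum_le_liminf_of_tendsto fun x => ?_
    have hd : ∀ {f : V → ℝ} (hf : ∀ z, |f z| ≤ m), Tendsto (fun K : ℕ => diffDir (c x.1)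
        (avgIter (1 / (K : ℝ)) c f (⌊t * K⌋₊ * M + x.1)) x.2) atTop
        (𝓝 (diffDir (c x.1) (heatSemigroup c M hf t) x.2)) := fun hf =>
      (tendsto_avgIter hper hf (le_of_lt ht) x.1 (x.2 + c x.1)).sub
        (tendsto_avgIter hper hf (le_of_lt ht) x.1 x.2)
    have hone : Tendsto (fun K : ℕ => 1 - 1 / (K : ℝ)) atTop (𝓝 (1 - 0)) :=
      tendsto_const_nhds.sub tendsto_one_div_atTop_nhds_zero_nat
    have h := hone.mul (((hd hf).mul (hd hg)).max (tendsto_const_nhds (x := (0 : ℝ))))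
    rw [sub_zero, one_mul] at h
    refine (ENNReal.continuous_ofReal.tendsto _).comp ?_
    simpa only [hP, hcper] using h
  calc _ ≤ ∫⁻ t in Ioi (0 : ℝ), liminf (fun K : ℕ => Φ K ⌊t * K⌋₊) atTop :=
        setLIntegral_mono' measurableSet_Ioi hlim
    _ ≤ liminf (fun K : ℕ => ∫⁻ t in Ioi (0 : ℝ), Φ K ⌊t * K⌋₊) atTop :=
        lintegral_liminf_le fun K => (measurable_from_nat (f := Φ K)).comp
          (Nat.measurable_floor.comp (measurable_id.mul_const (K : ℝ)))
    _ ≤ B := liminf_le_of_frequently_le'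
        ((eventually_ge_atTop 1).mono fun K hK => hdisc K hK).frequently

end Limit

/-! ### The heat extension on `G ^ N` -/

section Heat

open Filter Topology

variable {G : Type*} [AddCommGroup G] {N : ℕ}

/-- The directions `e_0, …, e_{N-1}, -e_0, …, -e_{N-1}`, repeated with period `2 N`.
The value `0` is never taken for `N ≠ 0`, and for `N = 0` all directions are equal. -/
def direction (e : G) (N : ℕ) (k : ℕ) : Fin N → G :=
  if h : k % (N + N) < N then unitElt e ⟨k % (N + N), h⟩
  else if h : k % (N + N) - N < N then -unitElt e ⟨k % (N + N) - N, h⟩ else 0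

theorem periodic_direction (e : G) (N : ℕ) : Function.Periodic (direction e N) (N + N) :=
  fun k => by unfold direction; simp only [Nat.add_mod_right]

theorem direction_castAdd (e : G) (i : Fin N) : direction e N (Fin.castAdd N i) = unitElt e i := by
  have h : (i : ℕ) % (N + N) = i := Nat.mod_eq_of_lt (by omega)
  simp [direction, h]

theorem direction_natAdd (e : G) (i : Fin N) : direction e N (Fin.natAdd N i) = -unitElt e i := by
  have h : ((i : ℕ) + N) % (N + N) = i + N := Nat.mod_eq_of_lt (by omega)
  simp [direction, h]

/-- The Laplacian as an operator on bounded functions: the sum of all differences in the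
directions `± e_i`. -/
noncomputable def laplacianOp (e : G) (N : ℕ) : BddFun (Fin N → G) →L[ℝ] BddFun (Fin N → G) :=
  ∑ k ∈ Finset.range (N + N), diffOp (direction e N k)

theorem laplacianOp_apply (e : G) (F : BddFun (Fin N → G)) (n : Fin N → G) :
    laplacianOp e N F n = laplacian e (fun z => F z) n := by
  have h : laplacianOp e N = ∑ i : Fin N, (diffOp (unitElt e i) + diffOp (-unitElt e i)) := by
    rw [laplacianOp, Finset.sum_range (fun k => diffOp (direction e N k)), Fin.sum_univ_add,
      Finset.sum_add_distrib]
    simp only [direction_castAdd, direction_natAdd]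
  rw [← evalOp_apply, h, map_sum, laplacian]
  refine Finset.sum_congr rfl fun i _ => ?_
  change F (n + unitElt e i) - F n + (F (n + -unitElt e i) - F n) = _
  simp only [dPlus, dMinus, add_sub_cancel_right, ← sub_eq_add_neg]
  ring

/-- The powers of the bounded operator are the iterates in the exponential series of `heatExt`. -/
theorem laplacianOp_pow_apply (e : G) {f : (Fin N → G) → ℝ} {m : ℝ} (hf : ∀ z, |f z| ≤ m) (k : ℕ) :
    ∀ n, (laplacianOp e N ^ k) (toBddFun hf) n = (laplacian e)^[k] f n := by
  induction k with
  | zero => intro n; rfl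
  | succ k ih =>
    intro n
    rw [pow_succ', Function.iterate_succ_apply', ← funext ih]
    exact laplacianOp_apply e _ n

theorem heatSemigroup_direction (e : G) {f : (Fin N → G) → ℝ} {m : ℝ} (hf : ∀ z, |f z| ≤ m)
    (t : ℝ) : heatSemigroup (direction e N) (N + N) hf t = heatExt e f t := by
  funext n
  have h := hasSum_map_exp_smul (evalOp (toBddFun hf) n) t (laplacianOp e N)
  simp only [evalOp_apply, laplacianOp_pow_apply] at h
  exact h.tsum_eq.symm

theorem continuous_heatExt (e : G) {f : (Fin N → G) → ℝ} {m : ℝ} (hf : ∀ z, |f z| ≤ m)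
    (n : Fin N → G) : Continuous fun t => heatExt e f t n := by
  simp only [← heatSemigroup_direction e hf]
  exact continuous_heatSemigroup _ _ hf n

/-- The differences in the directions `e_i` and `-e_i` contribute equally, which accounts for the
factor `2` in `bilinearForm`. -/
theorem bilinearForm_eq_lintegral [Countable (Fin N → G)] (e : G) {f g : (Fin N → G) → ℝ} {m : ℝ}
    (hf : ∀ z, |f z| ≤ m) (hg : ∀ z, |g z| ≤ m) :
    bilinearForm (fun x => max x 0) e f g =
      ∫⁻ t in Ioi (0 : ℝ), ∑ j : Fin (N + N), ∑' z, ENNReal.ofReal (max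
        (diffDir (direction e N j) (heatExt e f t) z *
          diffDir (direction e N j) (heatExt e g t) z) 0) := by
  have hmeas : ∀ i : Fin N, Measurable fun t => ∑' n : Fin N → G, ENNReal.ofReal
      (max (dPlus e i (heatExt e f t) n * dPlus e i (heatExt e g t) n) 0) := fun i =>
    Measurable.tsum fun n => by
      refine ENNReal.measurable_ofReal.comp (Continuous.measurable ?_)
      unfold dPlus
      exact (((continuous_heatExt e hf _).sub (continuous_heatExt e hf _)).mul
        ((continuous_heatExt e hg _).sub (continuous_heatExt e hg _))).max continuous_const
  rw [bilinearForm, ← lintegral_finsetSum _ fun i _ => hmeas i,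
    ← lintegral_const_mul _ (Finset.measurable_sum _ fun i _ => hmeas i)]
  refine lintegral_congr fun t => ?_
  rw [Fin.sum_univ_add, two_mul]
  simp only [direction_castAdd, direction_natAdd]
  congr 1
  refine Finset.sum_congr rfl fun i _ => ?_
  rw [← (Equiv.subRight (unitElt e i)).tsum_eq]
  refine tsum_congr fun n => ?_
  simp only [dPlus, diffDir, Equiv.subRight_apply, sub_add_cancel, ← sub_eq_add_neg]
  congr 2
  ring

end Heat

/-! ### The bilinear estimate -/

/-- Bounds by every admissible constant pass to the Choi constant. The hypothesis `h0` covers the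
product `∞ * 0 = 0`, which would arise if no finite constant were admissible. -/
theorem le_choiConst_mul {p : ℝ} {a B : ℝ≥0∞} (hB : B ≠ ∞) (h0 : B = 0 → a = 0)
    (h : ∀ C, ChoiInequality p C → a ≤ C * B) : a ≤ choiConst p * B := by
  rcases eq_or_ne B 0 with hB0 | hB0
  · rw [h0 hB0]; exact zero_le
  · rw [← ENNReal.div_le_iff hB0 hB]
    exact le_sInf fun C hC => (ENNReal.div_le_iff hB0 hB).2 (h C hC)

section Main

variable {G : Type*} [AddCommGroup G] {N : ℕ}

theorem countable_of_zmultiples_eq_top (e : G) (he : AddSubgroup.zmultiples e = ⊤) :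
    Countable G :=
  Function.Surjective.countable (f := fun k : ℤ => k • e) fun x =>
    AddSubgroup.mem_zmultiples_iff.1 (he ▸ AddSubgroup.mem_top x)

theorem exists_abs_le_of_finite_support {V : Type*} {f : V → ℝ} (hf : (Function.support f).Finite) :
    ∃ m, 0 ≤ m ∧ ∀ z, |f z| ≤ m := by
  refine ⟨∑ z ∈ hf.toFinset, |f z|, Finset.sum_nonneg fun _ _ => abs_nonneg _, fun z => ?_⟩
  by_cases hz : f z = 0
  · rw [hz, abs_zero]; exact Finset.sum_nonneg fun _ _ => abs_nonneg _
  · exact Finset.single_le_sum (f := fun z => |f z|) (fun _ _ => abs_nonneg _)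
      (hf.mem_toFinset.2 hz)

theorem lpNorm_ne_top {G : Type*} {p : ℝ} (hp : 0 < p) {f : (Fin N → G) → ℝ}
    (hf : (Function.support f).Finite) : lpNorm p f ≠ ∞ := by
  refine ENNReal.rpow_ne_top_of_nonneg (by positivity) ?_
  rw [tsum_eq_sum (s := hf.toFinset) fun z hz => ?_]
  · exact ENNReal.sum_ne_top.2 fun z _ => ENNReal.rpow_ne_top_of_nonneg hp.le enorm_ne_top
  · have hz' : f z = 0 := by simpa using hz
    rw [hz', enorm_zero, ENNReal.zero_rpow_of_pos hp]

theorem eq_zero_of_lpNorm_eq_zero {G : Type*} {p : ℝ} (hp : 0 < p) {f : (Fin N → G) → ℝ}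
    (h : lpNorm p f = 0) : f = 0 := by
  rw [lpNorm, ENNReal.rpow_eq_zero_iff_of_pos (by positivity), ENNReal.tsum_eq_zero] at h
  funext z
  simpa using (ENNReal.rpow_eq_zero_iff_of_pos hp).1 (h z)

theorem lpNorm_neg {G : Type*} (p : ℝ) (f : (Fin N → G) → ℝ) : lpNorm p (-f) = lpNorm p f := by
  simp [lpNorm]

theorem laplacian_neg (e : G) (f : (Fin N → G) → ℝ) : laplacian e (-f) = -laplacian e f := by
  funext n
  simp only [laplacian, dPlus, dMinus, Pi.neg_apply, ← Finset.sum_neg_distrib]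
  refine Finset.sum_congr rfl fun i _ => ?_
  ring

theorem heatExt_neg (e : G) (f : (Fin N → G) → ℝ) (t : ℝ) : heatExt e (-f) t = -heatExt e f t := by
  have h : ∀ k, (laplacian e)^[k] (-f) = -(laplacian e)^[k] f := fun k => by
    induction k with
    | zero => rfl
    | succ k ih => rw [Function.iterate_succ_apply', ih, laplacian_neg,
        ← Function.iterate_succ_apply' (laplacian e)]
  funext n
  simp only [heatExt, h, Pi.neg_apply, mul_neg, tsum_neg]

theorem heatExt_zero (e : G) (t : ℝ) (n : Fin N → G) : heatExt e 0 t n = 0 := by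
  have h := congrFun (heatExt_neg e (0 : (Fin N → G) → ℝ) t) n
  rw [neg_zero, Pi.neg_apply] at h
  linarith

/-- Changing the sign of `f` exchanges the positive and the negative part. -/
theorem bilinearForm_negPart_eq (e : G) (f g : (Fin N → G) → ℝ) :
    bilinearForm (fun x => max (-x) 0) e f g = bilinearForm (fun x => max x 0) e (-f) g := by
  simp only [bilinearForm, heatExt_neg, dPlus, Pi.neg_apply]
  ring_nf

theorem bilinearForm_posPart_le (e : G) (he : AddSubgroup.zmultiples e = ⊤) {p q : ℝ}
    (hpq : p.HolderConjugate q) {f g : (Fin N → G) → ℝ} (hf : (Function.support f).Finite)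
    (hg : (Function.support g).Finite) :
    bilinearForm (fun x => max x 0) e f g ≤ choiConst p * lpNorm p f * lpNorm q g := by
  have := countable_of_zmultiples_eq_top e he
  rw [mul_assoc]
  refine le_choiConst_mul
    (ENNReal.mul_ne_top (lpNorm_ne_top hpq.pos hf) (lpNorm_ne_top hpq.symm.pos hg))
    (fun h => ?_) fun C hC => ?_
  · rcases mul_eq_zero.1 h with h | h
    · simp [bilinearForm, dPlus, eq_zero_of_lpNorm_eq_zero hpq.pos h, heatExt_zero]
    · simp [bilinearForm, dPlus, eq_zero_of_lpNorm_eq_zero hpq.symm.pos h, heatExt_zero]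
  · obtain ⟨m₁, hm₁, hf'⟩ := exists_abs_le_of_finite_support hf
    obtain ⟨m₂, hm₂, hg'⟩ := exists_abs_le_of_finite_support hg
    have hF : ∀ z, |f z| ≤ m₁ + m₂ := fun z => (hf' z).trans (by linarith)
    have hG : ∀ z, |g z| ≤ m₁ + m₂ := fun z => (hg' z).trans (by linarith)
    have h := lintegral_sum_tsum_diffDir_exp_le (periodic_direction e N) hpq hC hF hG
    simp only [heatSemigroup_direction] at h
    rw [bilinearForm_eq_lintegral e hF hG]
    exact h

end Main

end DiscreteRiesz

theorem theorem4 {G : Type*} [AddCommGroup G] (e : G)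
    (he : AddSubgroup.zmultiples e = ⊤) (N : ℕ) (p q : ℝ) (hpq : p.HolderConjugate q)
    (f g : (Fin N → G) → ℝ) (hf : (Function.support f).Finite)
    (hg : (Function.support g).Finite) :
    DiscreteRiesz.bilinearForm (fun x => max x 0) e f g ≤
        DiscreteRiesz.choiConst p * DiscreteRiesz.lpNorm p f * DiscreteRiesz.lpNorm q g ∧
      DiscreteRiesz.bilinearForm (fun x => max (-x) 0) e f g ≤
        DiscreteRiesz.choiConst p * DiscreteRiesz.lpNorm p f * DiscreteRiesz.lpNorm q g := by
  refine ⟨DiscreteRiesz.bilinearForm_posPart_le e he hpq hf hg, ?_⟩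
  rw [DiscreteRiesz.bilinearForm_negPart_eq, ← DiscreteRiesz.lpNorm_neg p f]
  exact DiscreteRiesz.bilinearForm_posPart_le e he hpq (by rwa [Function.support_neg]) hg
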